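/- Let $(X,d)$ be a locally compact length metric space. For $x\in X$ and $0<r<R$, $\delta>0$, let $\mathcal U_\delta$ be the covering of the open ball $B_R(x)$ (with the restricted metric) by its balls of radius $\delta$, i.e. by the sets $B_\delta(y)\cap B_R(x)$ with $y\in B_R(x)$, and let $\pi_1(B_R(x),\mathcal U_\delta,x)$ be the normal subgroup of $\pi_1(B_R(x),x)$ generated by the classes of the loops $\alpha\cdot\beta\cdot\alpha^{-1}$, where $\beta$ is a loop lying in a member of $\mathcal U_\delta$ and $\alpha$ is a path in $B_R(x)$ from $x$ to $\beta(0)$. Let $\pi:\tilde B(x,R)^\delta\to B_R(x)$ be the covering space corresponding to this subgroup, and let the relative $\delta$-cover $\tilde B(x,r,R)^\delta$ be the connected component of $\pi^{-1}(B_r(x))$ containing the base point (the class of the constant path at $x$); up to deck transformations it does not depend on the choice of the component. Assume that the relative $\delta$-covers are stable: for every $x\in X$ and every $R>0$ there is $\delta_0>0$ such that for all $\delta,\delta'\in(0,\delta_0]$ the spaces $\tilde B(x,R/10,R)^{\delta}$ and $\tilde B(x,R/10,R)^{\delta'}$ are the same, i.e. there is a homeomorphism between them that commutes with the projections to $B_R(x)$.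 Then $X$ is semi-locally simply connected: for every $y\in X$ there is $r>0$ such that every loop in $B_r(y)$ is contractible in $X$. -/

import Mathlib

open Set Topology

noncomputable section

universe u

/-- `X` is a length metric space: the distance between two points is the infimum of the lengths
of the paths joining them. -/
def IsLengthMetricSpace (X : Type u) [MetricSpace X] : Prop :=
  ∀ x y : X, edist x y = ⨅ γ : Path x y, eVariationOn γ Set.univ

/-- Every point has a ball all of whose loops are contractible in `X`. -/
def IsSemilocallySimplyConnected (X : Type u) [MetricSpace X] : Prop :=
  ∀ y : X, ∃ r : ℝ, 0 < r ∧ ∀ (z : X) (γ : Path z z),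
    Set.range γ ⊆ Metric.ball y r → γ.Homotopic (Path.refl z)

namespace OpenCover

variable {B : Type u} [TopologicalSpace B]

/-- `π₁(B, 𝒰, b)`: the normal subgroup of `π₁(B, b)` generated by the classes of the loops that
run along a path `α` from `b`, then around a loop `β` lying in a member of `𝒰`, and then back
along `α`. -/
def subgroup (𝒰 : Set (Set B)) (b : B) : Subgroup (FundamentalGroup B b) :=
  Subgroup.normalClosure
    {g | ∃ (y : B) (α : Path b y) (β : Path y y), (∃ U ∈ 𝒰, Set.range β ⊆ U) ∧
      g = FundamentalGroup.fromPath
        (Path.Homotopic.Quotient.mk ((α.trans β).trans α.symm))}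

/-- Two paths from `b` are identified when they have the same endpoint and the loop formed by the
first path and the reverse of the second is in `π₁(B, 𝒰, b)`. -/
def pathSetoid (𝒰 : Set (Set B)) (b : B) : Setoid (Σ y : B, Path b y) where
  r p q := ∃ h : p.1 = q.1,
    FundamentalGroup.fromPath (Path.Homotopic.Quotient.mk (p.2.trans (q.2.cast rfl h).symm)) ∈
      subgroup 𝒰 b
  iseqv := by
    have key : ∀ {y : B} (p q r : Path.Homotopic.Quotient b y),
        FundamentalGroup.fromPath (p.trans r.symm) =
          FundamentalGroup.fromPath (q.trans r.symm) *
            FundamentalGroup.fromPath (p.trans q.symm) := by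
      intro y p q r
      rw [FundamentalGroup.mul_def]
      change p.trans r.symm = (p.trans q.symm).trans (q.trans r.symm)
      rw [Path.Homotopic.Quotient.trans_assoc, ← Path.Homotopic.Quotient.trans_assoc q.symm,
        Path.Homotopic.Quotient.symm_trans, Path.Homotopic.Quotient.refl_trans]
    refine ⟨?_, ?_, ?_⟩
    · rintro ⟨y, p⟩
      refine ⟨rfl, ?_⟩
      have := key (Path.Homotopic.Quotient.mk p) (Path.Homotopic.Quotient.mk p)
        (Path.Homotopic.Quotient.mk p)
      have h1 := left_eq_mul.mp this
      have : FundamentalGroup.fromPath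
        (Path.Homotopic.Quotient.mk (p.trans (p.cast rfl rfl).symm)) = 1 := h1
      rw [this]
      exact one_mem _
    · rintro ⟨y, p⟩ ⟨z, q⟩ ⟨h, hm⟩
      obtain rfl : y = z := h
      refine ⟨rfl, ?_⟩
      have h1 := inv_mem hm
      convert h1 using 1
      have := key (Path.Homotopic.Quotient.mk p) (Path.Homotopic.Quotient.mk q)
        (Path.Homotopic.Quotient.mk p)
      have h2 := key (Path.Homotopic.Quotient.mk p) (Path.Homotopic.Quotient.mk p)
        (Path.Homotopic.Quotient.mk p)
      rw [left_eq_mul.mp h2] at this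
      exact eq_inv_of_mul_eq_one_left this.symm
    · rintro ⟨y, p⟩ ⟨z, q⟩ ⟨w, r⟩ ⟨h, hm⟩ ⟨h', hm'⟩
      obtain rfl : y = z := h
      obtain rfl : y = w := h'
      refine ⟨rfl, ?_⟩
      have h1 := mul_mem hm' hm
      convert h1 using 1
      exact key (Path.Homotopic.Quotient.mk p) (Path.Homotopic.Quotient.mk q)
        (Path.Homotopic.Quotient.mk r)

/-- The covering space of `B` associated with the open covering `𝒰` and the base point `b`:
classes of paths issuing from `b`, modulo `π₁(B, 𝒰, b)`. -/
def Space (𝒰 : Set (Set B)) (b : B) : Type u := Quotient (pathSetoid 𝒰 b)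

/-- The class of a path. -/
def Space.mk (𝒰 : Set (Set B)) {b y : B} (γ : Path b y) : Space 𝒰 b :=
  Quotient.mk (pathSetoid 𝒰 b) ⟨y, γ⟩

/-- The class of the constant path. -/
def Space.base (𝒰 : Set (Set B)) (b : B) : Space 𝒰 b := Space.mk 𝒰 (Path.refl b)

/-- The projection sends the class of a path to its endpoint. -/
def Space.proj {𝒰 : Set (Set B)} {b : B} : Space 𝒰 b → B :=
  Quotient.lift Sigma.fst fun _ _ h => h.1

/-- The basic open sets of the covering space: the classes of the continuations of `γ` by paths
lying in `V`. -/
def Space.sheet (𝒰 : Set (Set B)) {b y : B} (γ : Path b y) (V : Set B) : Set (Space 𝒰 b) :=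
  {e | ∃ (z : B) (η : Path y z), Set.range η ⊆ V ∧ e = Space.mk 𝒰 (γ.trans η)}

instance (𝒰 : Set (Set B)) (b : B) : TopologicalSpace (Space 𝒰 b) :=
  TopologicalSpace.generateFrom
    {S | ∃ (y : B) (γ : Path b y) (V : Set B), IsOpen V ∧ y ∈ V ∧ S = Space.sheet 𝒰 γ V}

end OpenCover

/-- The open covering of a metric space by all its balls of radius `δ`. -/
def deltaBalls (B : Type u) [MetricSpace B] (δ : ℝ) : Set (Set B) :=
  Set.range fun y : B => Metric.ball y δ

/-- The `δ`-cover of the metric space `B`, with base point `b`. -/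
abbrev DeltaCover {B : Type u} [MetricSpace B] (b : B) (δ : ℝ) : Type u :=
  OpenCover.Space (deltaBalls B δ) b

section Relative

variable {X : Type u} [MetricSpace X]

/-- The centre of the ball `B_R(x)`, as a point of that ball. -/
def ballCenter (x : X) {R : ℝ} (hR : 0 < R) : Metric.ball x R :=
  ⟨x, Metric.mem_ball_self hR⟩

/-- The part of the `δ`-cover of `B_R(x)` lying over `B_r(x)`. -/
def overBall (x : X) (r : ℝ) {R : ℝ} (hR : 0 < R) (δ : ℝ) :
    Set (DeltaCover (ballCenter x hR) δ) :=
  {e | ((OpenCover.Space.proj e : Metric.ball x R) : X) ∈ Metric.ball x r}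

/-- The relative `δ`-cover `B̃(x, r, R)^δ`: the connected component, containing the base point, of
the part of the `δ`-cover of `B_R(x)` lying over `B_r(x)`. In a length space all the
components are equivalent under deck transformations. -/
def relativeDeltaCover (x : X) (r : ℝ) {R : ℝ} (hR : 0 < R) (δ : ℝ) :
    Set (DeltaCover (ballCenter x hR) δ) :=
  connectedComponentIn (overBall x r hR δ) (OpenCover.Space.base _ _)

/-- The relative covers `B̃(x, r, R)^δ` and `B̃(x, r, R)^δ'` are the same: there is a homeomorphism
between them that commutes with the projections to `B_R(x)`. -/
def SameRelativeCover (x : X) (r : ℝ) {R : ℝ} (hR : 0 < R) (δ δ' : ℝ) : Prop :=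
  ∃ φ : relativeDeltaCover x r hR δ ≃ₜ relativeDeltaCover x r hR δ',
    ∀ e, OpenCover.Space.proj (φ e).1 = OpenCover.Space.proj e.1

/-- The relative `δ`-covers `B̃(x, r, R)^δ` are stable: they are all the same for small `δ`. -/
def StableRelativeCover (x : X) (r : ℝ) {R : ℝ} (hR : 0 < R) : Prop :=
  ∃ δ₀ : ℝ, 0 < δ₀ ∧ ∀ δ δ' : ℝ, 0 < δ → δ ≤ δ₀ → 0 < δ' → δ' ≤ δ₀ →
    SameRelativeCover x r hR δ δ'

end Relative

end

/-!
Let `σ` be a short loop at `x`. It lies in one ball of the `δ₀`-covering of `B_R(x)`, so all its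
lifts to the `δ₀`-cover are closed. A homeomorphism over `B_R(x)` between the relative covers for
`δ` and `δ₀` carries lifts to lifts, because path lifting in these covers is unique; so the lift of
`σ` to the `δ`-cover is closed too, that is, `σ` belongs to the subgroup for `δ`, for every `δ ≤ δ₀`
(`SameRelativeCover.mem_subgroup`).

This has a geometric meaning in terms of homotopies that need not be continuous. A function `H` is
`ε`-nearly continuous if each point has a neighbourhood on which `H` differs by less than `ε` from
its value at the point. A loop in a ball of radius `δ` contracts `2δ`-nearly continuously, by simply
jumping to its base point. The classes of the loops with such contractions form a normal subgroup,
so every loop in the subgroup for `δ` has one (`approxHomotopic_refl_of_mem_subgroup`). Hence short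
loops contract, in a given ball, by `ε`-nearly continuous homotopies for every `ε > 0`; by the
Lebesgue number lemma, how short they have to be can be chosen uniformly on a compact set
(`exists_isApproxHomotopy_of_isCompact`).

Such a homotopy is made continuous by successive refinement. If `H` is `ε`-nearly continuous on the
unit square with `ε` small, the vertices of the squares of a fine grid have images close to each
other. As `X` is a length space, short paths join these images, and the resulting short loops, one
for each square of the grid, contract `ε'`-nearly continuously in small balls, with `ε'` as small as
one likes. These contractions fill the squares and fit together to an `ε'`-nearly continuous
function that is close to `H` and has the same values on the boundary
(`NearlyContinuousOn.exists_refinement`). With geometrically decreasing distances, the refinements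
stay in a compact ball and converge uniformly to a continuous function
(`IsLengthMetricSpace.exists_continuousOn`), which contracts the original loop.
-/

noncomputable section

/-! ### Nearly continuous functions and homotopies -/

/-- A function is `ε`-nearly continuous on `S` if close to each point `p` of `S` its values differ
from the value at `p` by less than `ε`. The neighbourhood may depend on `p`, so that nothing is
lost when such functions are glued along closed sets. -/
def NearlyContinuousOn {α X : Type*} [TopologicalSpace α] [MetricSpace X] (ε : ℝ) (f : α → X)
    (S : Set α) : Prop :=
  ∀ p ∈ S, ∀ᶠ q in 𝓝[S] p, dist (f q) (f p) < ε

namespace NearlyContinuousOn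

variable {α β X : Type*} [TopologicalSpace α] [TopologicalSpace β] [MetricSpace X] {ε : ℝ}

theorem of_continuousOn {f : α → X} {S : Set α} (hε : 0 < ε) (hf : ContinuousOn f S) :
    NearlyContinuousOn ε f S := fun p hp =>
  (hf p hp).eventually (Metric.ball_mem_nhds (f p) hε)

theorem congr {f g : α → X} {S : Set α} (hf : NearlyContinuousOn ε f S) (h : EqOn g f S) :
    NearlyContinuousOn ε g S := fun p hp => by
  filter_upwards [hf p hp, self_mem_nhdsWithin] with q hq hqS
  rwa [h hp, h hqS]

theorem mono {f : α → X} {S T : Set α} (hf : NearlyContinuousOn ε f S) (h : T ⊆ S) :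
    NearlyContinuousOn ε f T := fun p hp => (hf p (h hp)).filter_mono (nhdsWithin_mono _ h)

theorem comp {f : α → X} {S : Set α} {φ : β → α} {T : Set β} (hf : NearlyContinuousOn ε f S)
    (hφ : ContinuousOn φ T) (h : MapsTo φ T S) : NearlyContinuousOn ε (f ∘ φ) T := fun p hp =>
  ((hφ p hp).tendsto_nhdsWithin h).eventually (hf (φ p) (h hp))

theorem iUnion {ι : Type*} {f : α → X} {S : ι → Set α} (hS : LocallyFinite S)
    (hc : ∀ i, IsClosed (S i)) (hf : ∀ i, NearlyContinuousOn ε f (S i)) :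
    NearlyContinuousOn ε f (⋃ i, S i) := fun p _ => by
  rw [hS.nhdsWithin_iUnion, Filter.eventually_iSup]
  intro i
  by_cases hp : p ∈ S i
  · exact hf i p hp
  · rw [notMem_closure_iff_nhdsWithin_eq_bot.1 (by rwa [(hc i).closure_eq])]
    exact Filter.eventually_bot

theorem union {f : α → X} {S T : Set α} (hS : IsClosed S) (hT : IsClosed T)
    (h1 : NearlyContinuousOn ε f S) (h2 : NearlyContinuousOn ε f T) :
    NearlyContinuousOn ε f (S ∪ T) := by
  rw [union_eq_iUnion]
  exact iUnion (locallyFinite_of_finite _) (by rintro (_ | _) <;> assumption)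
    (by rintro (_ | _) <;> assumption)

/-- On a compact set a nearly continuous function has a uniform modulus, at the price of doubling
`ε`. -/
theorem exists_uniform {α : Type*} [PseudoMetricSpace α] {f : α → X} {K : Set α}
    (hK : IsCompact K) (hf : NearlyContinuousOn ε f K) :
    ∃ δ > 0, ∀ p ∈ K, ∀ q ∈ K, dist p q < δ → dist (f p) (f q) < 2 * ε := by
  have h : ∀ p ∈ K, ∃ r > 0, ∀ q ∈ K, dist q p < r → dist (f q) (f p) < ε := by
    intro p hp
    obtain ⟨r, hr, h⟩ := Metric.mem_nhdsWithin_iff.1 (hf p hp)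
    exact ⟨r, hr, fun q hq hqp => h ⟨hqp, hq⟩⟩
  choose! r hr h using h
  obtain ⟨δ, hδ, hL⟩ := lebesgue_number_lemma_of_metric (c := fun p : K => Metric.ball p.1 (r p.1))
    hK (fun _ => Metric.isOpen_ball)
    (fun p hp => mem_iUnion.2 ⟨⟨p, hp⟩, Metric.mem_ball_self (hr p hp)⟩)
  refine ⟨δ, hδ, fun p hp q hq hpq => ?_⟩
  obtain ⟨⟨c, hc⟩, hs⟩ := hL p hp
  have h1 := h c hc p hp (hs (Metric.mem_ball_self hδ))
  have h2 := h c hc q hq (hs (by rwa [Metric.mem_ball']))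
  have := dist_triangle_right (f p) (f q) (f c)
  linarith

end NearlyContinuousOn

section ApproxHomotopy

variable {X : Type*} [MetricSpace X] {ε : ℝ}

/-- `H` is an `ε`-nearly continuous homotopy, relative to the endpoints, from the path `γ` to the
path `γ'`. It is defined on the whole plane, the path parameter being the first coordinate, and is
constant along the outward rays orthogonal to the sides of the unit square. -/
structure IsApproxHomotopy (ε : ℝ) {a b : X} (γ γ' : Path a b) (H : ℝ × ℝ → X) : Prop where
  nearlyContinuousOn : NearlyContinuousOn ε H univ
  left : ∀ t s, t ≤ 0 → H (t, s) = a
  right : ∀ t s, 1 ≤ t → H (t, s) = b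
  bottom : ∀ t s, s ≤ 0 → H (t, s) = γ.extend t
  top : ∀ t s, 1 ≤ s → H (t, s) = γ'.extend t

/-- The paths `γ` and `γ'` are joined by an `ε`-nearly continuous homotopy. -/
def ApproxHomotopic (ε : ℝ) {a b : X} (γ γ' : Path a b) : Prop :=
  ∃ H, IsApproxHomotopy ε γ γ' H

namespace ApproxHomotopic

theorem of_homotopic (hε : 0 < ε) {a b : X} {γ γ' : Path a b} (h : γ.Homotopic γ') :
    ApproxHomotopic ε γ γ' := by
  obtain ⟨F⟩ := h
  let π : ℝ → unitInterval := projIcc 0 1 zero_le_one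
  refine ⟨fun p => F (π p.2, π p.1), ?_, ?_, ?_, ?_, ?_⟩
  · exact .of_continuousOn hε (F.continuous.comp (by fun_prop)).continuousOn
  · intro t s ht
    simp [π, projIcc_of_le_left _ ht]
  · intro t s ht
    simp [π, projIcc_of_right_le _ ht]
  · intro t s ht
    simp [π, projIcc_of_le_left _ ht, Path.extend, IccExtend]
  · intro t s ht
    simp [π, projIcc_of_right_le _ ht, Path.extend, IccExtend]

/-- No continuity is asked for, so a loop in a small set contracts by a jump. -/
theorem of_range_subset_ball {a c : X} {γ : Path a a} {r : ℝ}
    (hγ : range γ ⊆ Metric.ball c r) (hr : 2 * r ≤ ε) : ApproxHomotopic ε γ (Path.refl a) := by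
  have hb : ∀ t, γ.extend t ∈ Metric.ball c r := fun t => hγ (by
    rw [← Path.extend_range]; exact mem_range_self t)
  have ha : a ∈ Metric.ball c r := by simpa using hb 0
  have hH : ∀ p : ℝ × ℝ, (if p.2 ≤ 0 then γ.extend p.1 else a) ∈ Metric.ball c r := by
    intro p; split_ifs
    exacts [hb _, ha]
  refine ⟨fun p => if p.2 ≤ 0 then γ.extend p.1 else a, ?_, ?_, ?_, ?_, ?_⟩
  · refine fun p _ => .of_forall fun q => ?_
    have h1 := hH p
    have h2 := hH q
    rw [Metric.mem_ball] at h1 h2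
    exact (dist_triangle_right _ _ c).trans_lt (by linarith)
  · intro t s ht; simp [Path.extend_of_le_zero _ ht]
  · intro t s ht; simp [Path.extend_of_one_le _ ht]
  · intro t s ht; simp [ht]
  · intro t s ht; simp [show ¬ s ≤ 0 by linarith]

theorem symm {a b : X} {γ γ' : Path a b} (h : ApproxHomotopic ε γ γ') :
    ApproxHomotopic ε γ' γ := by
  obtain ⟨F, hF⟩ := h
  refine ⟨fun p => F (p.1, 1 - p.2), ?_, ?_, ?_, ?_, ?_⟩
  · exact hF.nearlyContinuousOn.comp (φ := fun p : ℝ × ℝ => (p.1, 1 - p.2))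
      (by fun_prop) (mapsTo_univ _ _)
  · intro t s ht; exact hF.left _ _ ht
  · intro t s ht; exact hF.right _ _ ht
  · intro t s hs; exact hF.top _ _ (by linarith)
  · intro t s hs; exact hF.bottom _ _ (by linarith)

theorem trans {a b : X} {γ₁ γ₂ γ₃ : Path a b} (h : ApproxHomotopic ε γ₁ γ₂)
    (h' : ApproxHomotopic ε γ₂ γ₃) : ApproxHomotopic ε γ₁ γ₃ := by
  obtain ⟨F, hF⟩ := h
  obtain ⟨G, hG⟩ := h'
  refine ⟨fun p => if p.2 ≤ 1 / 2 then F (p.1, 2 * p.2) else G (p.1, 2 * p.2 - 1),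
    ?_, ?_, ?_, ?_, ?_⟩
  · have : (univ : Set (ℝ × ℝ)) = {p | p.2 ≤ 1 / 2} ∪ {p | 1 / 2 ≤ p.2} := by
      ext p; simpa using le_total _ _
    rw [this]
    refine .union (isClosed_le (by fun_prop) (by fun_prop))
      (isClosed_le (by fun_prop) (by fun_prop)) ?_ ?_
    · refine (hF.nearlyContinuousOn.comp (φ := fun p : ℝ × ℝ => (p.1, 2 * p.2))
        (by fun_prop) (mapsTo_univ _ _)).congr fun p hp => ?_
      exact if_pos hp
    · refine (hG.nearlyContinuousOn.comp (φ := fun p : ℝ × ℝ => (p.1, 2 * p.2 - 1))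
        (by fun_prop) (mapsTo_univ _ _)).congr fun p hp => ?_
      have hp : 1 / 2 ≤ p.2 := hp
      split_ifs with h
      · rw [hF.top _ _ (by linarith), Function.comp_apply, hG.bottom _ _ (by linarith)]
      · rfl
  · intro t s ht; simp [hF.left _ _ ht, hG.left _ _ ht]
  · intro t s ht; simp [hF.right _ _ ht, hG.right _ _ ht]
  · intro t s hs; simp [show s ≤ 2⁻¹ by linarith, hF.bottom t (2 * s) (by linarith)]
  · intro t s hs
    simp [show ¬ s ≤ 2⁻¹ by rw [not_le]; linarith, hG.top t (2 * s - 1) (by linarith)]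

theorem hcomp {a b c : X} {γ₁ γ₂ : Path a b} {γ₁' γ₂' : Path b c} (h : ApproxHomotopic ε γ₁ γ₂)
    (h' : ApproxHomotopic ε γ₁' γ₂') : ApproxHomotopic ε (γ₁.trans γ₁') (γ₂.trans γ₂') := by
  obtain ⟨F, hF⟩ := h
  obtain ⟨G, hG⟩ := h'
  refine ⟨fun p => if p.1 ≤ 1 / 2 then F (2 * p.1, p.2) else G (2 * p.1 - 1, p.2),
    ?_, ?_, ?_, ?_, ?_⟩
  · have : (univ : Set (ℝ × ℝ)) = {p | p.1 ≤ 1 / 2} ∪ {p | 1 / 2 ≤ p.1} := by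
      ext p; simpa using le_total _ _
    rw [this]
    refine .union (isClosed_le (by fun_prop) (by fun_prop))
      (isClosed_le (by fun_prop) (by fun_prop)) ?_ ?_
    · refine (hF.nearlyContinuousOn.comp (φ := fun p : ℝ × ℝ => (2 * p.1, p.2))
        (by fun_prop) (mapsTo_univ _ _)).congr fun p hp => ?_
      exact if_pos hp
    · refine (hG.nearlyContinuousOn.comp (φ := fun p : ℝ × ℝ => (2 * p.1 - 1, p.2))
        (by fun_prop) (mapsTo_univ _ _)).congr fun p hp => ?_
      have hp : 1 / 2 ≤ p.1 := hp
      split_ifs with h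
      · rw [hF.right _ _ (by linarith), Function.comp_apply, hG.left _ _ (by linarith)]
      · rfl
  · intro t s ht
    simp [show t ≤ 2⁻¹ by linarith, hF.left (2 * t) s (by linarith)]
  · intro t s ht
    simp [show ¬ t ≤ 2⁻¹ by rw [not_le]; linarith, hG.right (2 * t - 1) s (by linarith)]
  · intro t s hs
    by_cases h : t ≤ 1 / 2
    · rw [Path.extend_trans_of_le_half _ _ h]
      exact (if_pos h).trans (hF.bottom _ _ hs)
    · rw [Path.extend_trans_of_half_le _ _ (not_le.1 h).le]
      exact (if_neg h).trans (hG.bottom _ _ hs)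
  · intro t s hs
    by_cases h : t ≤ 1 / 2
    · rw [Path.extend_trans_of_le_half _ _ h]
      exact (if_pos h).trans (hF.top _ _ hs)
    · rw [Path.extend_trans_of_half_le _ _ (not_le.1 h).le]
      exact (if_neg h).trans (hG.top _ _ hs)

/-- Conjugating a loop that contracts by a nearly continuous homotopy gives such a loop again. -/
theorem conj (hε : 0 < ε) {a b : X} {β : Path b b} (h : ApproxHomotopic ε β (Path.refl b))
    (α : Path a b) : ApproxHomotopic ε ((α.trans β).trans α.symm) (Path.refl a) := by
  have hr : ∀ {y z : X} (p : Path y z), ApproxHomotopic ε p p := fun p => of_homotopic hε (.refl p)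
  refine (((hr α).hcomp h).hcomp (hr α.symm)).trans (of_homotopic hε ?_)
  rw [← Path.Homotopic.Quotient.eq]
  simp

theorem of_conj (hε : 0 < ε) {a z w : X} {α : Path a z} {p q : Path z w}
    (h : ApproxHomotopic ε ((α.trans (p.trans q.symm)).trans α.symm) (Path.refl a)) :
    ApproxHomotopic ε p q := by
  have hr : ∀ {y z : X} (p : Path y z), ApproxHomotopic ε p p := fun p => of_homotopic hε (.refl p)
  -- `p ≃ α⁻¹ · (α · p · q⁻¹ · α⁻¹) · α · q`, and the loop in brackets contracts
  have h1 : p.Homotopic ((α.symm.trans ((α.trans (p.trans q.symm)).trans α.symm)).trans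
      (α.trans q)) := by
    rw [← Path.Homotopic.Quotient.eq]
    have e {c : X} (r : Path.Homotopic.Quotient z c) (β : Path.Homotopic.Quotient a z) :
        β.symm.trans (β.trans r) = r := by
      rw [← Path.Homotopic.Quotient.trans_assoc]; simp
    simp [Path.Homotopic.Quotient.trans_assoc, e]
  have h2 : ((α.symm.trans (Path.refl a)).trans (α.trans q)).Homotopic q := by
    rw [← Path.Homotopic.Quotient.eq]
    simp only [Path.Homotopic.Quotient.mk_trans, Path.Homotopic.Quotient.mk_symm,
      Path.Homotopic.Quotient.mk_refl, Path.Homotopic.Quotient.trans_refl]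
    rw [← Path.Homotopic.Quotient.trans_assoc]
    simp
  exact ((of_homotopic hε h1).trans (((hr _).hcomp h).hcomp (hr _))).trans (of_homotopic hε h2)

end ApproxHomotopic

/-- The classes of the loops at `b` that contract by an `ε`-nearly continuous homotopy, as a
subgroup of the fundamental group. -/
def approxNullSubgroup (hε : 0 < ε) (b : X) : Subgroup (FundamentalGroup X b) where
  carrier := {g | ∃ γ : Path b b, g = FundamentalGroup.fromPath (.mk γ) ∧
    ApproxHomotopic ε γ (Path.refl b)}
  one_mem' := ⟨Path.refl b, rfl, .of_homotopic hε (.refl _)⟩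
  mul_mem' := by
    rintro _ _ ⟨γ, rfl, h⟩ ⟨γ', rfl, h'⟩
    exact ⟨γ'.trans γ, rfl, (h'.hcomp h).trans
      (.of_homotopic hε (Path.Homotopic.Quotient.eq.1 (by simp)))⟩
  inv_mem' := by
    rintro _ ⟨γ, rfl, h⟩
    have hr : ApproxHomotopic ε γ.symm γ.symm := .of_homotopic hε (.refl _)
    refine ⟨γ.symm, rfl, ?_⟩
    -- `γ⁻¹ ≃ γ⁻¹ · 1`, which is nearly homotopic to `γ⁻¹ · γ ≃ 1`
    exact ((ApproxHomotopic.of_homotopic hε (Path.Homotopic.Quotient.eq.1 (by simp))).trans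
      (hr.hcomp h.symm)).trans (.of_homotopic hε (Path.Homotopic.Quotient.eq.1 (by simp)))

instance (hε : 0 < ε) (b : X) : (approxNullSubgroup hε b).Normal where
  conj_mem := by
    rintro _ ⟨γ, rfl, h⟩ g
    obtain ⟨α, rfl⟩ := Path.Homotopic.Quotient.mk_surjective g
    refine ⟨(α.symm.trans γ).trans α, ?_, ?_⟩
    · rw [FundamentalGroup.mul_def, FundamentalGroup.mul_def, FundamentalGroup.inv_def]
      simp
    · simpa using h.conj hε α.symm

/-- A loop that is trivial modulo the loops lying in balls of radius `δ` contracts by a nearly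
continuous homotopy. -/
theorem approxHomotopic_refl_of_mem_subgroup {δ : ℝ} (hε : 0 < ε) (hδ : 2 * δ ≤ ε) {b : X}
    {γ : Path b b}
    (h : FundamentalGroup.fromPath (.mk γ) ∈ OpenCover.subgroup (deltaBalls X δ) b) :
    ApproxHomotopic ε γ (Path.refl b) := by
  have hle : OpenCover.subgroup (deltaBalls X δ) b ≤ approxNullSubgroup hε b := by
    refine Subgroup.normalClosure_le_normal ?_
    rintro _ ⟨y, α, β, ⟨_, ⟨c, rfl⟩, hβ⟩, rfl⟩
    exact ⟨_, rfl, (ApproxHomotopic.of_range_subset_ball hβ hδ).conj hε α⟩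
  obtain ⟨γ', h1, h2⟩ := hle h
  exact (ApproxHomotopic.of_homotopic hε (Path.Homotopic.Quotient.eq.1 h1)).trans h2

end ApproxHomotopy

/-! ### The covering space of an open covering and stability -/

namespace OpenCover

section

variable {B : Type u} [TopologicalSpace B] {𝒰 : Set (Set B)} {b : B}

theorem Space.mk_eq_mk_iff {y : B} {γ γ' : Path b y} :
    Space.mk 𝒰 γ = Space.mk 𝒰 γ' ↔
      FundamentalGroup.fromPath (.mk (γ.trans γ'.symm)) ∈ subgroup 𝒰 b :=
  _root_.Quotient.eq.trans ⟨fun ⟨_, h⟩ => h, fun h => ⟨rfl, h⟩⟩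

theorem Space.mk_eq_of_homotopic {y : B} {γ γ' : Path b y} (h : γ.Homotopic γ') :
    Space.mk 𝒰 γ = Space.mk 𝒰 γ' := by
  rw [Space.mk_eq_mk_iff, Path.Homotopic.Quotient.mk_trans, Path.Homotopic.Quotient.eq.2 h,
    Path.Homotopic.Quotient.mk_symm, Path.Homotopic.Quotient.trans_symm]
  exact one_mem _

theorem Space.mk_trans_eq_mk_trans_iff {y z : B} {γ γ' : Path b y} {η : Path y z} :
    Space.mk 𝒰 (γ.trans η) = Space.mk 𝒰 (γ'.trans η) ↔ Space.mk 𝒰 γ = Space.mk 𝒰 γ' := by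
  rw [Space.mk_eq_mk_iff, Space.mk_eq_mk_iff]
  have : Path.Homotopic.Quotient.mk ((γ.trans η).trans (γ'.trans η).symm) =
      .mk (γ.trans γ'.symm) := by
    simp [← Path.Homotopic.Quotient.trans_assoc]
    simp [Path.Homotopic.Quotient.trans_assoc]
  rw [this]

/-- Continuing a path in two ways inside a member of the covering gives the same point. -/
theorem Space.mk_trans_eq_of_subset {y z : B} (γ : Path b y) {η η' : Path y z} {U : Set B}
    (hU : U ∈ 𝒰) (h : range η ⊆ U) (h' : range η' ⊆ U) :
    Space.mk 𝒰 (γ.trans η) = Space.mk 𝒰 (γ.trans η') := by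
  rw [Space.mk_eq_mk_iff]
  refine Subgroup.subset_normalClosure ⟨y, γ, η.trans η'.symm, ⟨U, hU, ?_⟩, ?_⟩
  · rw [Path.trans_range, Path.symm_range]
    exact union_subset h h'
  · simp

theorem Space.exists_mk_eq (e : Space 𝒰 b) {y : B} (h : Space.proj e = y) :
    ∃ γ : Path b y, e = Space.mk 𝒰 γ := by
  subst h
  induction e using _root_.Quotient.inductionOn with
  | h p => exact ⟨p.2, rfl⟩

theorem Space.isOpen_sheet {y : B} (γ : Path b y) {V : Set B} (hV : IsOpen V) (hy : y ∈ V) :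
    IsOpen (Space.sheet 𝒰 γ V) :=
  TopologicalSpace.isOpen_generateFrom_of_mem ⟨y, γ, V, hV, hy, rfl⟩

theorem Space.mk_mem_sheet {y : B} (γ : Path b y) {V : Set B} (hy : y ∈ V) :
    Space.mk 𝒰 γ ∈ Space.sheet 𝒰 γ V :=
  ⟨y, Path.refl y, by simpa using hy, Space.mk_eq_of_homotopic ⟨(Path.Homotopy.transRefl γ).symm⟩⟩

/-- Over a member of the covering, sheets are disjoint or equal, and project injectively. -/
theorem Space.eq_iff_of_mem_sheet {y : B} {γ γ' : Path b y} {U : Set B} (hU : U ∈ 𝒰)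
    {e e' : Space 𝒰 b} (he : e ∈ Space.sheet 𝒰 γ U) (he' : e' ∈ Space.sheet 𝒰 γ' U)
    (h : Space.proj e = Space.proj e') : e = e' ↔ Space.mk 𝒰 γ = Space.mk 𝒰 γ' := by
  obtain ⟨z, η, hη, rfl⟩ := he
  obtain ⟨z', η', hη', rfl⟩ := he'
  obtain rfl : z = z' := h
  rw [← Space.mk_trans_eq_of_subset γ' hU hη hη', Space.mk_trans_eq_mk_trans_iff]

theorem Space.isLocallyInjective_proj (ho : ∀ U ∈ 𝒰, IsOpen U) (hc : ⋃₀ 𝒰 = univ) :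
    IsLocallyInjective (Space.proj : Space 𝒰 b → B) := by
  intro e
  obtain ⟨y, γ, rfl⟩ : ∃ (y : B) (γ : Path b y), e = Space.mk 𝒰 γ :=
    ⟨_, Space.exists_mk_eq e rfl⟩
  obtain ⟨U, hU, hy⟩ := mem_sUnion.1 (hc ▸ mem_univ y)
  exact ⟨_, Space.isOpen_sheet γ (ho U hU) hy, Space.mk_mem_sheet γ hy,
    fun e₁ h₁ e₂ h₂ h => (Space.eq_iff_of_mem_sheet hU h₁ h₂ h).2 rfl⟩

theorem Space.isSeparatedMap_proj (ho : ∀ U ∈ 𝒰, IsOpen U) (hc : ⋃₀ 𝒰 = univ) :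
    IsSeparatedMap (Space.proj : Space 𝒰 b → B) := by
  intro e e' h hne
  obtain ⟨y, γ, rfl⟩ : ∃ (y : B) (γ : Path b y), e = Space.mk 𝒰 γ :=
    ⟨_, Space.exists_mk_eq e rfl⟩
  obtain ⟨γ', rfl⟩ := Space.exists_mk_eq e' h.symm
  obtain ⟨U, hU, hy⟩ := mem_sUnion.1 (hc ▸ mem_univ y)
  refine ⟨_, _, Space.isOpen_sheet γ (ho U hU) hy, Space.isOpen_sheet γ' (ho U hU) hy,
    Space.mk_mem_sheet γ hy, Space.mk_mem_sheet γ' hy, disjoint_left.2 fun e₁ h₁ h₂ => hne ?_⟩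
  exact (Space.eq_iff_of_mem_sheet hU h₁ h₂ rfl).1 rfl

/-- The lift of the path `σ` that starts at the class of `τ`. -/
def Space.lift (𝒰 : Set (Set B)) {y z : B} (τ : Path b y) (σ : Path y z) (t : unitInterval) :
    Space 𝒰 b :=
  Space.mk 𝒰 (τ.trans ((σ.subpath 0 t).cast σ.source.symm rfl))

theorem Space.proj_lift {y z : B} (τ : Path b y) (σ : Path y z) (t : unitInterval) :
    Space.proj (Space.lift 𝒰 τ σ t) = σ t := rfl

theorem Space.mk_cast {y z : B} (γ : Path b y) (h : z = y) :
    Space.mk 𝒰 (γ.cast rfl h) = Space.mk 𝒰 γ := by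
  subst h; rfl

theorem Space.lift_zero {y z : B} (τ : Path b y) (σ : Path y z) :
    Space.lift 𝒰 τ σ 0 = Space.mk 𝒰 τ := by
  have h : (σ.subpath 0 0).cast σ.source.symm rfl = (Path.refl y).cast rfl σ.source := by
    ext t; simp
  rw [lift, h]
  exact (Space.mk_cast (τ.trans (Path.refl y)) σ.source).trans
    (Space.mk_eq_of_homotopic ⟨Path.Homotopy.transRefl τ⟩)

theorem Space.lift_one {y z : B} (τ : Path b y) (σ : Path y z) :
    Space.lift 𝒰 τ σ 1 = Space.mk 𝒰 (τ.trans σ) := by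
  have h : (σ.subpath 0 1).cast σ.source.symm rfl = σ.cast rfl σ.target := by
    ext t; simp
  rw [lift, h]
  exact Space.mk_cast (τ.trans σ) σ.target

theorem Space.continuous_lift {y z : B} (τ : Path b y) (σ : Path y z) :
    Continuous (Space.lift 𝒰 τ σ) := by
  refine continuous_generateFrom_iff.2 ?_
  rintro _ ⟨w, γ, V, hV, hw, rfl⟩
  rw [isOpen_iff_mem_nhds]
  rintro t ⟨v, η, hη, h⟩
  obtain rfl : σ t = v := congrArg Space.proj h
  have hv : σ t ∈ V := hη ⟨1, η.target⟩
  have h1 : ∀ᶠ t' in 𝓝 t, uIcc t t' ⊆ σ ⁻¹' V :=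
    (Filter.Tendsto.uIcc tendsto_const_nhds Filter.tendsto_id).eventually
      (Filter.eventually_smallSets_subset.2 ((hV.preimage σ.continuous).mem_nhds hv))
  filter_upwards [h1] with t' ht'
  refine ⟨σ t', η.trans (σ.subpath t t'), ?_, ?_⟩
  · rw [Path.trans_range, Path.range_subpath]
    exact union_subset hη (image_subset_iff.2 ht')
  · have h2 := (Space.mk_trans_eq_mk_trans_iff (η := σ.subpath t t')).2 h
    refine (Space.mk_eq_of_homotopic ?_).trans (h2.trans (Space.mk_eq_of_homotopic ?_))
    · have h3 : (Path.Homotopic.Quotient.mk ((σ.subpath 0 t').cast σ.source.symm rfl)) =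
          .mk (((σ.subpath 0 t).cast σ.source.symm rfl).trans (σ.subpath t t')) := by
        have := (Path.Homotopic.Quotient.eq.2 ⟨Path.Homotopy.subpathTransSubpath σ 0 t t'⟩)
        have := congrArg (fun q => Path.Homotopic.Quotient.cast q σ.source.symm rfl) this
        rw [← Path.Homotopic.Quotient.mk_cast, ← Path.Homotopic.Quotient.mk_cast] at this
        exact this.symm
      rw [← Path.Homotopic.Quotient.eq]
      simp only [Path.Homotopic.Quotient.mk_trans] at h3 ⊢
      rw [h3, Path.Homotopic.Quotient.trans_assoc]
    · exact ⟨Path.Homotopy.transAssoc _ _ _⟩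

/-- A loop in `π₁(B, 𝒰, b)` lifts to a loop at every point of the covering space over `b`. -/
theorem Space.mk_trans_eq_self {τ σ : Path b b}
    (h : FundamentalGroup.fromPath (.mk σ) ∈ subgroup 𝒰 b) :
    Space.mk 𝒰 (τ.trans σ) = Space.mk 𝒰 τ := by
  rw [Space.mk_eq_mk_iff]
  have hn : (subgroup 𝒰 b).Normal := Subgroup.normalClosure_normal
  have h' := hn.conj_mem' _ h (FundamentalGroup.fromPath (.mk τ))
  simp only [Path.Homotopic.Quotient.mk_trans, Path.Homotopic.Quotient.mk_symm,
    Path.Homotopic.Quotient.trans_assoc]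
  exact h'

theorem Space.mk_eq_base_iff {σ : Path b b} :
    Space.mk 𝒰 σ = Space.base 𝒰 b ↔
      FundamentalGroup.fromPath (.mk σ) ∈ subgroup 𝒰 b := by
  rw [Space.base, Space.mk_eq_mk_iff]
  simp

end

end OpenCover

open OpenCover

section

variable {X : Type u} [MetricSpace X]

theorem isOpen_of_mem_deltaBalls {δ : ℝ} : ∀ U ∈ deltaBalls X δ, IsOpen U := by
  rintro _ ⟨y, rfl⟩
  exact Metric.isOpen_ball

theorem sUnion_deltaBalls {δ : ℝ} (hδ : 0 < δ) : ⋃₀ deltaBalls X δ = univ :=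
  eq_univ_of_forall fun y => ⟨_, ⟨y, rfl⟩, Metric.mem_ball_self hδ⟩

/-- If the relative covers for `δ` and `δ'` are the same, a loop in the small ball that lifts to
loops in the one lifts to loops in the other. -/
theorem SameRelativeCover.mem_subgroup {x : X} {r R : ℝ} {hR : 0 < R} {δ δ' : ℝ}
    (hδ' : 0 < δ') (h : SameRelativeCover x r hR δ δ')
    {σ : Path (ballCenter x hR) (ballCenter x hR)}
    (hσ : ∀ t, (σ t : X) ∈ Metric.ball x r)
    (hm : FundamentalGroup.fromPath (.mk σ) ∈ subgroup (deltaBalls (Metric.ball x R) δ') _) :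
    FundamentalGroup.fromPath (.mk σ) ∈ subgroup (deltaBalls (Metric.ball x R) δ) _ := by
  obtain ⟨φ, hφ⟩ := h
  let L := Space.lift (deltaBalls (Metric.ball x R) δ) (Path.refl (ballCenter x hR)) σ
  have hL : Continuous L := Space.continuous_lift _ _
  have hL0 : L 0 = Space.base _ _ := Space.lift_zero _ _
  have hmem : ∀ t, L t ∈ relativeDeltaCover x r hR δ := fun t => by
    refine (isPreconnected_range hL).subset_connectedComponentIn ⟨0, hL0⟩ ?_ ⟨t, rfl⟩
    rintro _ ⟨t, rfl⟩
    exact hσ t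
  let f : unitInterval → DeltaCover (ballCenter x hR) δ' := fun t => (φ ⟨L t, hmem t⟩).1
  have hf : Continuous f := by fun_prop
  have hfp : ∀ t, Space.proj (f t) = σ t := fun t => (hφ _).trans (Space.proj_lift _ _ t)
  obtain ⟨τ, hτ⟩ := Space.exists_mk_eq (f 0) ((hfp 0).trans σ.source)
  -- both `f` and the lift of `σ` from the class of `τ` are lifts of `σ` with the same start
  have hu := IsSeparatedMap.eq_of_comp_eq
    (Space.isSeparatedMap_proj isOpen_of_mem_deltaBalls (sUnion_deltaBalls hδ'))
    (Space.isLocallyInjective_proj isOpen_of_mem_deltaBalls (sUnion_deltaBalls hδ'))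
    hf (Space.continuous_lift τ σ) (funext hfp) 0 (hτ.trans (Space.lift_zero τ σ).symm)
  have h1 : f 1 = f 0 := by
    rw [hτ, hu, Space.lift_one, Space.mk_trans_eq_self hm]
  have h2 : L 1 = L 0 := congrArg Subtype.val (φ.injective (Subtype.ext h1))
  have hL1 : L 1 = Space.mk _ ((Path.refl _).trans σ) := Space.lift_one _ _
  rw [hL0, hL1, Space.mk_eq_of_homotopic ⟨Path.Homotopy.reflTrans σ⟩] at h2
  exact Space.mk_eq_base_iff.1 h2

/-- Stability of the relative covers makes a short loop at the centre contract in the ball by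
homotopies that are as nearly continuous as one likes. -/
theorem StableRelativeCover.exists_approxHomotopic_refl {x : X} {R : ℝ} {hR : 0 < R}
    (h : StableRelativeCover x (R / 10) hR) :
    ∃ ρ > 0, ρ ≤ R ∧ ∀ σ : Path (ballCenter x hR) (ballCenter x hR),
      (∀ t, (σ t : X) ∈ Metric.ball x ρ) → ∀ ε > 0, ApproxHomotopic ε σ (Path.refl _) := by
  obtain ⟨δ₀, hδ₀, h⟩ := h
  refine ⟨min δ₀ (R / 10), lt_min hδ₀ (by positivity), (min_le_right _ _).trans (by linarith),
    fun σ hσ ε hε => ?_⟩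
  have hm : FundamentalGroup.fromPath (.mk σ) ∈ subgroup (deltaBalls (Metric.ball x R) δ₀) _ := by
    refine Subgroup.subset_normalClosure ⟨_, Path.refl _, σ, ⟨_, ⟨ballCenter x hR, rfl⟩, ?_⟩, ?_⟩
    · rintro _ ⟨t, rfl⟩
      exact Metric.ball_subset_ball (min_le_left _ _) (hσ t)
    · simp
  have hδ : 0 < min δ₀ (ε / 2) := lt_min hδ₀ (by positivity)
  exact approxHomotopic_refl_of_mem_subgroup hε (by linarith [min_le_right δ₀ (ε / 2)])
    ((h (min δ₀ (ε / 2)) δ₀ hδ (min_le_left _ _) hδ₀ le_rfl).mem_subgroup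
      hδ₀ (fun t => Metric.ball_subset_ball (min_le_right _ _) (hσ t)) hm)

end

/-! ### Short loops contract nearly continuously -/

section

variable {X : Type u} [MetricSpace X]

theorem IsLengthMetricSpace.exists_path (hX : IsLengthMetricSpace X) {x y : X} {r : ℝ}
    (h : dist x y < r) : ∃ γ : Path x y, ∀ t, γ t ∈ Metric.ball x r := by
  have h1 : edist x y < ENNReal.ofReal r := by
    rw [edist_dist]
    exact (ENNReal.ofReal_lt_ofReal_iff (dist_nonneg.trans_lt h)).2 h
  rw [hX, iInf_lt_iff] at h1
  obtain ⟨γ, hγ⟩ := h1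
  refine ⟨γ, fun t => ?_⟩
  have h2 := (eVariationOn.edist_le γ (mem_univ t) (mem_univ 0)).trans_lt hγ
  rwa [γ.source, edist_lt_ofReal] at h2

/-- The path `γ` as a path in a subspace containing it. -/
def Path.toSubtype {a b : X} (γ : Path a b) (S : Set X) (h : ∀ t, γ t ∈ S) :
    Path (⟨a, by simpa using h 0⟩ : S) ⟨b, by simpa using h 1⟩ where
  toFun t := ⟨γ t, h t⟩
  continuous_toFun := by fun_prop
  source' := Subtype.ext γ.source
  target' := Subtype.ext γ.target

/-- Two paths with the same endpoints in a sufficiently small ball are joined, within a given larger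
ball, by homotopies that are as nearly continuous as one likes. -/
theorem StableRelativeCover.exists_isApproxHomotopy (hX : IsLengthMetricSpace X) {x : X} {R : ℝ}
    {hR : 0 < R} (h : StableRelativeCover x (R / 10) hR) :
    ∃ ρ > 0, ρ ≤ R ∧ ∀ (z w : X) (p q : Path z w), (∀ t, p t ∈ Metric.ball x ρ) →
      (∀ t, q t ∈ Metric.ball x ρ) → ∀ ε > 0,
      ∃ H, IsApproxHomotopy ε p q H ∧ ∀ u, H u ∈ Metric.ball x R := by
  obtain ⟨ρ, hρ, hρR, h⟩ := h.exists_approxHomotopic_refl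
  refine ⟨ρ, hρ, hρR, fun z w p q hp hq ε hε => ?_⟩
  have hS := Metric.ball_subset_ball (x := x) hρR
  have hz : z ∈ Metric.ball x ρ := by simpa using hp 0
  obtain ⟨α, hα⟩ := hX.exists_path (Metric.mem_ball'.1 hz)
  let α' := α.toSubtype (Metric.ball x R) fun t => hS (hα t)
  let p' := p.toSubtype (Metric.ball x R) fun t => hS (hp t)
  let q' := q.toSubtype (Metric.ball x R) fun t => hS (hq t)
  have hloop := h ((α'.trans (p'.trans q'.symm)).trans α'.symm) (fun t => by
    have hr : range ((α'.trans (p'.trans q'.symm)).trans α'.symm) ⊆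
        Subtype.val ⁻¹' Metric.ball x ρ := by
      simp only [Path.trans_range, Path.symm_range, union_subset_iff]
      refine ⟨⟨?_, ?_, ?_⟩, ?_⟩ <;> rintro _ ⟨t, rfl⟩
      exacts [hα t, hp t, hq t, hα t]
    exact hr ⟨t, rfl⟩) ε hε
  obtain ⟨H, hH⟩ := ApproxHomotopic.of_conj hε hloop
  refine ⟨fun u => (H u : X), ⟨hH.nearlyContinuousOn, ?_, ?_, ?_, ?_⟩, fun u => (H u).2⟩
  · intro t s ht; rw [hH.left _ _ ht]
  · intro t s ht; rw [hH.right _ _ ht]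
  · intro t s ht; rw [hH.bottom _ _ ht]; rfl
  · intro t s ht; rw [hH.top _ _ ht]; rfl

theorem exists_isApproxHomotopy_of_isCompact (hX : IsLengthMetricSpace X)
    (hstable : ∀ (x : X) (R : ℝ) (hR : 0 < R), StableRelativeCover x (R / 10) hR)
    {K : Set X} (hK : IsCompact K) {R : ℝ} (hR : 0 < R) :
    ∃ ρ > 0, ∀ z ∈ K, ∀ (w : X) (p q : Path z w), (∀ t, p t ∈ Metric.ball z ρ) →
      (∀ t, q t ∈ Metric.ball z ρ) → ∀ ε > 0,
      ∃ H, IsApproxHomotopy ε p q H ∧ ∀ u, H u ∈ Metric.ball z R := by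
  have h := fun x : X => (hstable x (R / 2) (half_pos hR)).exists_isApproxHomotopy hX
  choose ρ hρ hρR h using h
  obtain ⟨δ, hδ, hL⟩ := lebesgue_number_lemma_of_metric (c := fun x : X => Metric.ball x (ρ x))
    hK (fun _ => Metric.isOpen_ball) (fun x _ => mem_iUnion.2 ⟨x, Metric.mem_ball_self (hρ x)⟩)
  refine ⟨δ, hδ, fun z hz w p q hp hq ε hε => ?_⟩
  obtain ⟨x, hx⟩ := hL z hz
  obtain ⟨H, hH, hb⟩ := h x z w p q (fun t => hx (hp t)) (fun t => hx (hq t)) ε hε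
  refine ⟨H, hH, fun u => ?_⟩
  have h1 : dist z x < ρ x := hx (Metric.mem_ball_self hδ)
  have h2 : dist (H u) x < R / 2 := hb u
  exact (dist_triangle_right (H u) z x).trans_lt (by linarith [hρR x])

end

/-! ### Filling a square -/

section

variable {X : Type u} [MetricSpace X] {ε : ℝ}

/-- The closed unit square. -/
def unitSquare : Set (ℝ × ℝ) := Icc 0 1 ×ˢ Icc 0 1

theorem isCompact_unitSquare : IsCompact unitSquare := isCompact_Icc.prod isCompact_Icc

theorem mem_unitSquare {x y : ℝ} :
    (x, y) ∈ unitSquare ↔ (0 ≤ x ∧ x ≤ 1) ∧ 0 ≤ y ∧ y ≤ 1 := Iff.rfl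

/-- The point `(x, y)` of the unit square lies on the antidiagonal with parameter `(x + y) / 2`; the
second coordinate is its relative position on that antidiagonal. At the two corners where the
antidiagonal is a point, that is `0 / 0 = 0`. -/
def antidiagonalCoord (p : ℝ × ℝ) : ℝ × ℝ :=
  ((p.1 + p.2) / 2, min p.2 (1 - p.1) / (min p.2 (1 - p.1) + min p.1 (1 - p.2)))

theorem antidiagonalCoord_mem {p : ℝ × ℝ} (hp : p ∈ unitSquare) :
    antidiagonalCoord p ∈ unitSquare := by
  obtain ⟨x, y⟩ := p
  obtain ⟨⟨h1, h2⟩, h3, h4⟩ := mem_unitSquare.1 hp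
  have hA : 0 ≤ min y (1 - x) := le_min h3 (by linarith)
  have hB : 0 ≤ min x (1 - y) := le_min h1 (by linarith)
  refine mem_unitSquare.2 ⟨⟨by linarith, by linarith⟩, by positivity, ?_⟩
  exact div_le_one_of_le₀ (by linarith) (by positivity)

theorem antidiagonalCoord_bottom {t : ℝ} (ht : t ∈ Icc (0 : ℝ) 1) :
    antidiagonalCoord (t, 0) = (t / 2, 0) := by
  simp [antidiagonalCoord, ht.2]

theorem antidiagonalCoord_right {t : ℝ} (ht : t ∈ Icc (0 : ℝ) 1) :
    antidiagonalCoord (1, t) = ((1 + t) / 2, 0) := by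
  simp [antidiagonalCoord, ht.1]

theorem antidiagonalCoord_left {t : ℝ} (ht : t ∈ Ioc (0 : ℝ) 1) :
    antidiagonalCoord (0, t) = (t / 2, 1) := by
  simp [antidiagonalCoord, ht.2, ht.1.ne']

theorem antidiagonalCoord_top {t : ℝ} (ht : t ∈ Ico (0 : ℝ) 1) :
    antidiagonalCoord (t, 1) = ((t + 1) / 2, 1) := by
  have h : 1 - t ≠ 0 := by linarith [ht.2]
  simp [antidiagonalCoord, ht.1, h]

theorem continuousAt_antidiagonalCoord {p : ℝ × ℝ} (hp : p ∈ unitSquare) (h0 : p ≠ (0, 0))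
    (h1 : p ≠ (1, 1)) : ContinuousAt antidiagonalCoord p := by
  obtain ⟨x, y⟩ := p
  obtain ⟨⟨hx, hx'⟩, hy, hy'⟩ := mem_unitSquare.1 hp
  have : min y (1 - x) + min x (1 - y) ≠ 0 := by
    simp only [ne_eq, Prod.mk.injEq, not_and] at h0 h1
    intro h
    grind
  unfold antidiagonalCoord
  refine ContinuousAt.prodMk (by fun_prop) (ContinuousAt.div ?_ ?_ this) <;> fun_prop

/-- A nearly continuous homotopy between the two ways around a square fills the square: it is
composed with `antidiagonalCoord`, which sends the two ways to the two horizontal sides. The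
doubling of `ε` pays for the jumps of that map at two corners. -/
theorem IsApproxHomotopy.exists_square {v₀₀ v₁₀ v₀₁ v₁₁ : X} {b : Path v₀₀ v₁₀} {r : Path v₁₀ v₁₁}
    {l : Path v₀₀ v₀₁} {t : Path v₀₁ v₁₁} {H : ℝ × ℝ → X}
    (hH : IsApproxHomotopy ε (b.trans r) (l.trans t) H) :
    ∃ G : ℝ × ℝ → X, NearlyContinuousOn (2 * ε) G unitSquare ∧ (∀ p, G p ∈ range H) ∧
      ∀ x ∈ Icc (0 : ℝ) 1, G (x, 0) = b.extend x ∧ G (1, x) = r.extend x ∧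
        G (0, x) = l.extend x ∧ G (x, 1) = t.extend x := by
  refine ⟨H ∘ antidiagonalCoord, fun p hp => ?_, fun p => mem_range_self _, fun x hx => ?_⟩
  · obtain ⟨δ, hδ, hu⟩ := NearlyContinuousOn.exists_uniform isCompact_unitSquare
      (hH.nearlyContinuousOn.mono (subset_univ _))
    have hfst : ∀ p, ContinuousAt (fun q => (antidiagonalCoord q).1) p := fun p => by
      unfold antidiagonalCoord; fun_prop
    have hev : ∀ p, ∀ᶠ q in 𝓝[unitSquare] p,
        dist (antidiagonalCoord q).1 (antidiagonalCoord p).1 < δ := fun p =>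
      ((hfst p).tendsto.mono_left nhdsWithin_le_nhds).eventually (Metric.ball_mem_nhds _ hδ)
    -- near the two corners at which the coordinates jump, `H` is almost constant
    by_cases h0 : p = (0, 0)
    · subst h0
      filter_upwards [hev (0, 0), self_mem_nhdsWithin] with q hq hqS
      have hm := antidiagonalCoord_mem hqS
      have := hu (antidiagonalCoord q) hm (0, (antidiagonalCoord q).2)
        ⟨⟨le_rfl, zero_le_one⟩, hm.2⟩ (by simpa [antidiagonalCoord, Prod.dist_eq, hδ] using hq)
      rw [hH.left 0 _ le_rfl] at this
      simpa [antidiagonalCoord_bottom, hH.left] using this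
    by_cases h1 : p = (1, 1)
    · subst h1
      filter_upwards [hev (1, 1), self_mem_nhdsWithin] with q hq hqS
      have hm := antidiagonalCoord_mem hqS
      have := hu (antidiagonalCoord q) hm (1, (antidiagonalCoord q).2)
        ⟨⟨zero_le_one, le_rfl⟩, hm.2⟩ (by simpa [antidiagonalCoord, Prod.dist_eq] using hq)
      rw [hH.right 1 _ le_rfl] at this
      simpa [antidiagonalCoord_right, hH.right] using this
    have hc := (continuousAt_antidiagonalCoord hp h0 h1).continuousWithinAt (s := unitSquare)
    have hm := hc.tendsto_nhdsWithin (t := unitSquare) (fun q hq => antidiagonalCoord_mem hq)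
    have hball := (hc.tendsto).eventually (Metric.ball_mem_nhds _ hδ)
    filter_upwards [hball, self_mem_nhdsWithin] with q hq hqS
    exact hu _ (antidiagonalCoord_mem hqS) _ (antidiagonalCoord_mem hp) hq
  · simp only [Function.comp_apply]
    refine ⟨?_, ?_, ?_, ?_⟩
    · rw [antidiagonalCoord_bottom hx, hH.bottom _ _ le_rfl,
        Path.extend_trans_of_le_half _ _ (by linarith [hx.2])]
      congr 1; ring
    · rw [antidiagonalCoord_right hx, hH.bottom _ _ le_rfl,
        Path.extend_trans_of_half_le _ _ (by linarith [hx.1])]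
      congr 1; ring
    · obtain rfl | h := hx.1.eq_or_lt
      · rw [antidiagonalCoord_bottom hx, hH.left _ _ (by simp), Path.extend_zero]
      rw [antidiagonalCoord_left ⟨h, hx.2⟩, hH.top _ _ le_rfl,
        Path.extend_trans_of_le_half _ _ (by linarith [hx.2])]
      congr 1; ring
    · obtain rfl | h := hx.2.eq_or_lt
      · rw [antidiagonalCoord_right hx, hH.right _ _ (by norm_num), Path.extend_one]
      rw [antidiagonalCoord_top ⟨hx.1, h⟩, hH.top _ _ le_rfl,
        Path.extend_trans_of_half_le _ _ (by linarith [hx.1])]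
      congr 1; ring

end

/-! ### Refinement on a grid -/

section

variable {X : Type u} [MetricSpace X] {ε : ℝ}

/-- The index of the interval containing `x` when `[0, 1]` is cut into `N` equal intervals. -/
def gridIndex (N : ℕ) (x : ℝ) : ℕ := min ⌊N * x⌋₊ (N - 1)

theorem gridIndex_lt {N : ℕ} (hN : 0 < N) (x : ℝ) : gridIndex N x < N :=
  (min_le_right _ _).trans_lt (Nat.sub_lt hN one_pos)

theorem mul_sub_gridIndex_mem {N : ℕ} (hN : 0 < N) {x : ℝ} (hx : x ∈ Icc (0 : ℝ) 1) :
    N * x - gridIndex N x ∈ Icc (0 : ℝ) 1 := by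
  have hN' : (0 : ℝ) < N := Nat.cast_pos.2 hN
  have h0 : 0 ≤ N * x := mul_nonneg hN'.le hx.1
  have h1 := Nat.floor_le h0
  have h2 := Nat.lt_floor_add_one (N * x)
  have h3 : ((N - 1 : ℕ) : ℝ) = N - 1 := by push_cast [Nat.cast_pred hN]; rfl
  have h4 : N * x ≤ N := mul_le_of_le_one_right hN'.le hx.2
  unfold gridIndex
  rcases le_total ⌊N * x⌋₊ (N - 1) with h | h
  · rw [min_eq_left h]
    exact ⟨by linarith, by linarith⟩
  · rw [min_eq_right h, h3]
    have : ((N - 1 : ℕ) : ℝ) ≤ ⌊N * x⌋₊ := Nat.cast_le.2 h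
    exact ⟨by linarith, by linarith⟩

/-- Functions on the intervals of a subdivision that agree at the common endpoints define a function
on the whole. -/
theorem apply_gridIndex {Y : Type*} {N : ℕ} {f : ℕ → ℝ → Y}
    (hf : ∀ i, i + 1 < N → f i 1 = f (i + 1) 0) {i : ℕ} (hi : i < N) {x : ℝ}
    (hx : N * x - i ∈ Icc (0 : ℝ) 1) :
    f (gridIndex N x) (N * x - gridIndex N x) = f i (N * x - i) := by
  obtain ⟨h0, h1⟩ := hx
  unfold gridIndex
  rcases h1.eq_or_lt with h | h
  · have hfl : ⌊(N : ℝ) * x⌋₊ = i + 1 := by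
      rw [show (N : ℝ) * x = ((i + 1 : ℕ) : ℝ) by push_cast; linarith, Nat.floor_natCast]
    rw [hfl]
    rcases Nat.lt_or_ge (i + 1) N with h' | h'
    · rw [min_eq_left (by omega), h, hf i h']
      congr 1
      push_cast; linarith
    · rw [min_eq_right (by omega), show N - 1 = i by omega]
  · have hfl : ⌊(N : ℝ) * x⌋₊ = i :=
      (Nat.floor_eq_iff (by linarith [(Nat.cast_nonneg i : (0 : ℝ) ≤ i)])).2
        ⟨by linarith, by linarith⟩
    rw [hfl, min_eq_left (by omega)]

/-- Nearly continuous functions on the squares of a grid that agree on the common sides define a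
nearly continuous function on the unit square. -/
theorem NearlyContinuousOn.exists_grid {N : ℕ} (hN : 0 < N) {F : ℕ → ℕ → ℝ × ℝ → X}
    (hF : ∀ i j, i < N → j < N → NearlyContinuousOn ε (F i j) unitSquare)
    (h₁ : ∀ i j, i + 1 < N → j < N → ∀ t ∈ Icc (0 : ℝ) 1, F i j (1, t) = F (i + 1) j (0, t))
    (h₂ : ∀ i j, i < N → j + 1 < N → ∀ t ∈ Icc (0 : ℝ) 1, F i j (t, 1) = F i (j + 1) (t, 0)) :
    ∃ G : ℝ × ℝ → X, NearlyContinuousOn ε G unitSquare ∧ ∀ p ∈ unitSquare, ∀ i j, i < N → j < N →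
      (N * p.1 - i, N * p.2 - j) ∈ unitSquare → G p = F i j (N * p.1 - i, N * p.2 - j) := by
  let G : ℝ × ℝ → X := fun p => F (gridIndex N p.1) (gridIndex N p.2)
    (N * p.1 - gridIndex N p.1, N * p.2 - gridIndex N p.2)
  have hG : ∀ p ∈ unitSquare, ∀ i j, i < N → j < N →
      (N * p.1 - i, N * p.2 - j) ∈ unitSquare → G p = F i j (N * p.1 - i, N * p.2 - j) := by
    rintro ⟨x, y⟩ hp i j hi hj hij
    have e1 := apply_gridIndex
      (f := fun i u => F i (gridIndex N y) (u, N * y - gridIndex N y))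
      (fun i hi => h₁ i _ hi (gridIndex_lt hN y) _ (mul_sub_gridIndex_mem hN hp.2)) hi hij.1
    have e2 := apply_gridIndex (f := fun j v => F i j (N * x - i, v))
      (fun j hj => h₂ i j hi hj _ hij.1) hj hij.2
    exact e1.trans e2
  refine ⟨G, ?_, hG⟩
  let S : Fin N × Fin N → Set (ℝ × ℝ) := fun k =>
    unitSquare ∩ (fun p => (N * p.1 - k.1, N * p.2 - k.2)) ⁻¹' unitSquare
  have hφ : ∀ k : Fin N × Fin N,
      Continuous (fun p : ℝ × ℝ => ((N * p.1 - k.1, N * p.2 - k.2) : ℝ × ℝ)) := fun k => by fun_prop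
  have hS : unitSquare = ⋃ k, S k := by
    refine Subset.antisymm (fun p hp => mem_iUnion.2 ?_) (iUnion_subset fun k => inter_subset_left)
    exact ⟨(⟨_, gridIndex_lt hN p.1⟩, ⟨_, gridIndex_lt hN p.2⟩), hp,
      mul_sub_gridIndex_mem hN hp.1, mul_sub_gridIndex_mem hN hp.2⟩
  rw [hS]
  refine .iUnion (locallyFinite_of_finite _) (fun k => isCompact_unitSquare.isClosed.inter
    (isCompact_unitSquare.isClosed.preimage (hφ k))) fun k => ?_
  exact ((hF k.1 k.2 k.1.2 k.2.2).comp (hφ k).continuousOn (fun p hp => hp.2)).congr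
    fun p hp => hG p hp.1 _ _ k.1.2 k.2.2 hp.2

/-- The boundary of the unit square. -/
def squareBoundary : Set (ℝ × ℝ) :=
  {p ∈ unitSquare | p.1 = 0 ∨ p.1 = 1 ∨ p.2 = 0 ∨ p.2 = 1}

/-- The points `H P` and `H Q` can be joined by a path that stays close to `H P` if `P` and `Q` are
close, and that follows `H` along the segment from `P` to `Q` if `H` is continuous there. -/
theorem IsLengthMetricSpace.exists_edge (hX : IsLengthMetricSpace X) {H : ℝ × ℝ → X} {δ η : ℝ}
    (hH : ∀ p ∈ unitSquare, ∀ q ∈ unitSquare, dist p q < δ → dist (H p) (H q) < η)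
    (P Q : ℝ × ℝ) : ∃ e : Path (H P) (H Q),
      (P ∈ unitSquare → Q ∈ unitSquare → dist P Q < δ →
        ∀ t, e t ∈ Metric.ball (H P) η) ∧
      (ContinuousOn (fun t : ℝ => H (AffineMap.lineMap P Q t)) (Icc 0 1) →
        ∀ t ∈ Icc (0 : ℝ) 1, e.extend t = H (AffineMap.lineMap P Q t)) := by
  by_cases hc : ContinuousOn (fun t : ℝ => H (AffineMap.lineMap P Q t)) (Icc 0 1)
  · refine ⟨Path.ofLine hc (by simp) (by simp), fun hP hQ hPQ t => ?_, fun _ t ht => ?_⟩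
    · have hconv : Convex ℝ unitSquare := (convex_Icc 0 1).prod (convex_Icc 0 1)
      have hm : AffineMap.lineMap P Q (t : ℝ) ∈ unitSquare :=
        hconv.lineMap_mem hP hQ t.2
      refine hH _ hm _ hP ?_
      rw [dist_lineMap_left]
      refine lt_of_le_of_lt (mul_le_of_le_one_left dist_nonneg ?_) hPQ
      rw [Real.norm_of_nonneg t.2.1]
      exact t.2.2
    · rw [Path.extend_apply _ ht]
      rfl
  · by_cases h : P ∈ unitSquare ∧ Q ∈ unitSquare ∧ dist P Q < δ
    · obtain ⟨e, he⟩ := hX.exists_path (hH P h.1 Q h.2.1 h.2.2)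
      exact ⟨e, fun _ _ _ => he, fun h => absurd h hc⟩
    · obtain ⟨e, -⟩ := hX.exists_path (lt_add_one (dist (H P) (H Q)))
      exact ⟨e, fun h1 h2 h3 => absurd ⟨h1, h2, h3⟩ h, fun h => absurd h hc⟩

/-- A nearly continuous function on the unit square is refined: on each square of a fine grid, it is
replaced by a filling of the boundary of that square, which has first been made a loop by short
paths between the vertices. -/
theorem NearlyContinuousOn.exists_refinement (hX : IsLengthMetricSpace X) {K : Set X} {ρ c : ℝ}
    (hK : ∀ z ∈ K, ∀ (w : X) (p q : Path z w), (∀ t, p t ∈ Metric.ball z ρ) →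
      (∀ t, q t ∈ Metric.ball z ρ) → ∀ ε > 0,
      ∃ H, IsApproxHomotopy ε p q H ∧ ∀ u, H u ∈ Metric.ball z c)
    (hρ : 4 * ε ≤ ρ) (hc : 2 * ε ≤ c) {H : ℝ × ℝ → X} (hH : NearlyContinuousOn ε H unitSquare)
    (hHK : MapsTo H unitSquare K) (hb : ContinuousOn H squareBoundary) {ε' : ℝ} (hε' : 0 < ε') :
    ∃ H' : ℝ × ℝ → X, NearlyContinuousOn ε' H' unitSquare ∧ EqOn H' H squareBoundary ∧
      ∀ p ∈ unitSquare, dist (H p) (H' p) ≤ 2 * c := by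
  obtain ⟨δ, hδ, hu⟩ := hH.exists_uniform isCompact_unitSquare
  obtain ⟨M, hM⟩ := exists_nat_one_div_lt hδ
  obtain ⟨N, hN, hNδ⟩ : ∃ N : ℕ, 0 < N ∧ 1 / (N : ℝ) < δ := 
    ⟨M + 1, M.succ_pos, by exact_mod_cast hM⟩
  have hN' : (0 : ℝ) < N := Nat.cast_pos.2 hN
  let V : ℕ → ℕ → ℝ × ℝ := fun i j => (i / N, j / N)
  have hV : ∀ i j, i ≤ N → j ≤ N → V i j ∈ unitSquare := fun i j hi hj =>
    mem_unitSquare.2 ⟨⟨by positivity, div_le_one_of_le₀ (Nat.cast_le.2 hi) hN'.le⟩,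
      by positivity, div_le_one_of_le₀ (Nat.cast_le.2 hj) hN'.le⟩
  have hV1 : ∀ i j, dist (V i j) (V (i + 1) j) < δ := fun i j => by
    simp only [V, Prod.dist_eq, dist_self, Real.dist_eq]
    rw [← sub_div, max_lt_iff]
    refine ⟨?_, hδ⟩
    rwa [show (i : ℝ) - (i + 1 : ℕ) = -1 by push_cast; ring, abs_div, abs_neg, abs_one,
      abs_of_pos hN']
  have hV2 : ∀ i j, dist (V i j) (V i (j + 1)) < δ := fun i j => by
    simp only [V, Prod.dist_eq, dist_self, Real.dist_eq]
    rw [← sub_div, max_lt_iff]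
    refine ⟨hδ, ?_⟩
    rwa [show (j : ℝ) - (j + 1 : ℕ) = -1 by push_cast; ring, abs_div, abs_neg, abs_one,
      abs_of_pos hN']
  have hL1 : ∀ i j (t : ℝ), AffineMap.lineMap (V i j) (V (i + 1) j) t =
      (((i + t) / N, j / N) : ℝ × ℝ) := fun i j t => by
      simp only [V, AffineMap.lineMap_apply, vsub_eq_sub, vadd_eq_add, Prod.mk_sub_mk, Prod.smul_mk,
        Prod.mk_add_mk, smul_eq_mul]
      congr 1 <;> (push_cast; ring)
  have hL2 : ∀ i j (t : ℝ), AffineMap.lineMap (V i j) (V i (j + 1)) t =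
      ((i / N, (j + t) / N) : ℝ × ℝ) := fun i j t => by
      simp only [V, AffineMap.lineMap_apply, vsub_eq_sub, vadd_eq_add, Prod.mk_sub_mk, Prod.smul_mk,
        Prod.mk_add_mk, smul_eq_mul]
      congr 1 <;> (push_cast; ring)
  have hfrac : ∀ i, i < N → ∀ t ∈ Icc (0 : ℝ) 1, (i + t) / N ∈ Icc (0 : ℝ) 1 := fun i hi t ht => by
    have : (i : ℝ) + 1 ≤ N := by exact_mod_cast hi
    exact ⟨div_nonneg (by linarith [ht.1, (Nat.cast_nonneg i : (0 : ℝ) ≤ i)]) hN'.le,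
      div_le_one_of_le₀ (by linarith [ht.2]) hN'.le⟩
  -- horizontal edges `e` and vertical edges `g`; on the boundary of the square they follow `H`
  choose e he he' using fun i j => hX.exists_edge hu (V i j) (V (i + 1) j)
  choose g hg hg' using fun i j => hX.exists_edge hu (V i j) (V i (j + 1))
  have heb : ∀ i j, i < N → j = 0 ∨ j = N → ∀ t ∈ Icc (0 : ℝ) 1,
      (e i j).extend t = H ((i + t) / N, j / N) := fun i j hi hj t ht => by
    rw [he' i j ?_ t ht, hL1]
    simp only [hL1]
    refine hb.comp (by fun_prop) fun t ht => ?_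
    rcases hj with rfl | rfl
    · exact ⟨⟨hfrac i hi t ht, by simp⟩, by simp⟩
    · exact ⟨⟨hfrac i hi t ht, by simp [hN'.ne']⟩, by simp [hN'.ne']⟩
  have hgb : ∀ i j, j < N → i = 0 ∨ i = N → ∀ t ∈ Icc (0 : ℝ) 1,
      (g i j).extend t = H (i / N, (j + t) / N) := fun i j hj hi t ht => by
    rw [hg' i j ?_ t ht, hL2]
    simp only [hL2]
    refine hb.comp (by fun_prop) fun t ht => ?_
    rcases hi with rfl | rfl
    · exact ⟨⟨by simp, hfrac j hj t ht⟩, by simp⟩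
    · exact ⟨⟨by simp [hN'.ne'], hfrac j hj t ht⟩, by simp [hN'.ne']⟩
  have hfill : ∀ i j, ∃ G : ℝ × ℝ → X, i < N → j < N →
      NearlyContinuousOn ε' G unitSquare ∧ (∀ p, G p ∈ Metric.ball (H (V i j)) c) ∧
      ∀ x ∈ Icc (0 : ℝ) 1, G (x, 0) = (e i j).extend x ∧ G (1, x) = (g (i + 1) j).extend x ∧
        G (0, x) = (g i j).extend x ∧ G (x, 1) = (e i (j + 1)).extend x := fun i j => by
    by_cases hij : i < N ∧ j < N
    swap
    · exact ⟨H, fun h1 h2 => absurd ⟨h1, h2⟩ hij⟩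
    obtain ⟨hi, hj⟩ := hij
    have h00 := hV i j hi.le hj.le
    have h10 := hV (i + 1) j hi hj.le
    have h01 := hV i (j + 1) hi.le hj
    have h11 := hV (i + 1) (j + 1) hi hj
    have b1 := he i j h00 h10 (hV1 i j)
    have b2 := hg (i + 1) j h10 h11 (hV2 _ j)
    have b3 := hg i j h00 h01 (hV2 i j)
    have b4 := he i (j + 1) h01 h11 (hV1 i _)
    have htwo : ∀ {v : X} (p : Path (H (V i j)) v) {w : X} (q : Path v w),
        (∀ t, p t ∈ Metric.ball (H (V i j)) (2 * ε)) → (∀ t, q t ∈ Metric.ball v (2 * ε)) →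
        ∀ t, (p.trans q) t ∈ Metric.ball (H (V i j)) ρ := fun {v} p {w} q hp hq t => by
      have hr : range (p.trans q) ⊆ Metric.ball (H (V i j)) ρ := by
        rw [Path.trans_range]
        have hv : dist v (H (V i j)) < 2 * ε := by simpa using hp 1
        refine union_subset ?_ ?_ <;> rintro _ ⟨t, rfl⟩
        · have h1 : dist (p t) (H (V i j)) < 2 * ε := hp t
          exact h1.trans_le (by linarith [dist_nonneg.trans_lt h1])
        · have h1 : dist (q t) v < 2 * ε := hq t
          exact (dist_triangle _ v _).trans_lt (by linarith)
      exact hr ⟨t, rfl⟩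
    obtain ⟨A, hA, hAc⟩ := hK _ (hHK h00) _ ((e i j).trans (g (i + 1) j))
      ((g i j).trans (e i (j + 1))) (htwo _ _ b1 b2) (htwo _ _ b3 b4) (ε' / 2) (half_pos hε')
    obtain ⟨G, hG, hGr, hGb⟩ := hA.exists_square
    refine ⟨G, fun _ _ => ⟨by rwa [mul_div_cancel₀ ε' two_ne_zero] at hG, fun p => ?_, hGb⟩⟩
    obtain ⟨q, hq⟩ := hGr p
    exact hq ▸ hAc q
  choose F hF using hfill
  obtain ⟨G, hG, hGF⟩ := NearlyContinuousOn.exists_grid (ε := ε') hN (F := F)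
    (fun i j hi hj => (hF i j hi hj).1)
    (fun i j hi hj t ht => by
      rw [((hF i j (by omega) hj).2.2 t ht).2.1, ((hF (i + 1) j hi hj).2.2 t ht).2.2.1])
    (fun i j hi hj t ht => by
      rw [((hF i j hi (by omega)).2.2 t ht).2.2.2, ((hF i (j + 1) hi hj).2.2 t ht).1])
  -- every point in coordinates relative to a square of the grid that contains it
  have hloc : ∀ p ∈ unitSquare, ∃ i j u v, i < N ∧ j < N ∧ u ∈ Icc (0 : ℝ) 1 ∧ v ∈ Icc (0 : ℝ) 1 ∧
      p = ((i + u) / N, (j + v) / N) ∧ G p = F i j (u, v) := fun p hp => by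
    have hm1 := mul_sub_gridIndex_mem hN hp.1
    have hm2 := mul_sub_gridIndex_mem hN hp.2
    have h1 := gridIndex_lt hN p.1
    have h2 := gridIndex_lt hN p.2
    refine ⟨_, _, _, _, h1, h2, hm1, hm2, ?_, hGF p hp _ _ h1 h2 ⟨hm1, hm2⟩⟩
    ext <;> field_simp <;> ring
  refine ⟨G, hG, fun p hp => ?_, fun p hp => ?_⟩
  · obtain ⟨i, j, u, v, hi, hj, hu, hv, rfl, hGp⟩ := hloc p hp.1
    rw [hGp]
    have hi' : (i : ℝ) + 1 ≤ N := by exact_mod_cast hi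
    have hj' : (j : ℝ) + 1 ≤ N := by exact_mod_cast hj
    have hi0 : (0 : ℝ) ≤ i := Nat.cast_nonneg i
    have hj0 : (0 : ℝ) ≤ j := Nat.cast_nonneg j
    have hFij := (hF i j hi hj).2.2
    rcases hp.2 with h | h | h | h
    · have h : (i + u) / (N : ℝ) = 0 := h
      rw [div_eq_zero_iff, or_iff_left hN'.ne'] at h
      obtain rfl : u = 0 := by linarith [hu.1]
      obtain rfl : i = 0 := by exact_mod_cast (by linarith : (i : ℝ) = 0)
      rw [(hFij v hv).2.2.1, hgb _ _ hj (.inl rfl) v hv, add_zero]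
    · have h : (i + u) / (N : ℝ) = 1 := h
      rw [div_eq_one_iff_eq hN'.ne'] at h
      obtain rfl : u = 1 := by linarith [hu.2]
      have hiN : i + 1 = N := by exact_mod_cast h
      rw [(hFij v hv).2.1, hgb _ _ hj (.inr hiN) v hv, Nat.cast_succ]
    · have h : (j + v) / (N : ℝ) = 0 := h
      rw [div_eq_zero_iff, or_iff_left hN'.ne'] at h
      obtain rfl : v = 0 := by linarith [hv.1]
      obtain rfl : j = 0 := by exact_mod_cast (by linarith : (j : ℝ) = 0)
      rw [(hFij u hu).1, heb _ _ hi (.inl rfl) u hu, add_zero]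
    · have h : (j + v) / (N : ℝ) = 1 := h
      rw [div_eq_one_iff_eq hN'.ne'] at h
      obtain rfl : v = 1 := by linarith [hv.2]
      have hjN : j + 1 = N := by exact_mod_cast h
      rw [(hFij u hu).2.2.2, heb _ _ hi (.inr hjN) u hu, Nat.cast_succ]
  · obtain ⟨i, j, u, v, hi, hj, hu', hv', rfl, hGp⟩ := hloc p hp
    have h1 : dist (G ((i + u) / N, (j + v) / N)) (H (V i j)) < c := hGp ▸ (hF i j hi hj).2.1 _
    have h2 : dist (H ((i + u) / N, (j + v) / N)) (H (V i j)) < 2 * ε := by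
      refine hu _ hp _ (hV i j hi.le hj.le) (lt_of_le_of_lt ?_ hNδ)
      simp only [V, Prod.dist_eq, Real.dist_eq]
      rw [← sub_div, ← sub_div, add_sub_cancel_left, add_sub_cancel_left, abs_div, abs_div,
        abs_of_pos hN', abs_of_nonneg hu'.1, abs_of_nonneg hv'.1]
      exact max_le (by gcongr; exact hu'.2) (by gcongr; exact hv'.2)
    exact (dist_triangle_right _ _ (H (V i j))).trans (by linarith)

end

/-! ### The limit of the refinements -/

section

variable {X : Type u} [MetricSpace X]

theorem IsApproxHomotopy.continuousOn_squareBoundary {z : X} {γ : Path z z} {H : ℝ × ℝ → X}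
    {ε : ℝ} (hH : IsApproxHomotopy ε γ (Path.refl z) H) : ContinuousOn H squareBoundary := by
  have hS : squareBoundary ⊆ {p | p.2 = 0} ∪ {p | p.1 = 0 ∨ p.1 = 1 ∨ p.2 = 1} := by
    rintro p ⟨-, h | h | h | h⟩ <;> simp [h]
  refine ContinuousOn.mono (ContinuousOn.union_of_isClosed ?_ ?_ ?_ ?_) hS
  · refine (γ.extend.continuous.comp continuous_fst).continuousOn.congr fun p hp => ?_
    exact hH.bottom p.1 p.2 (le_of_eq hp)
  · refine (continuousOn_const (c := z)).congr fun p hp => ?_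
    rcases hp with h | h | h
    · exact hH.left p.1 p.2 h.le
    · exact hH.right p.1 p.2 h.ge
    · exact hH.top p.1 p.2 h.ge
  · exact isClosed_eq continuous_snd continuous_const
  · exact (isClosed_eq continuous_fst continuous_const).union
      ((isClosed_eq continuous_fst continuous_const).union
        (isClosed_eq continuous_snd continuous_const))

theorem tendsto_div_two_pow_zero (C : ℝ) :
    Filter.Tendsto (fun n : ℕ => C / 2 ^ n) Filter.atTop (𝓝 0) := by
  simpa [div_eq_mul_inv] using (tendsto_pow_atTop_nhds_zero_of_lt_one (r := (1 / 2 : ℝ))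
    (by norm_num) (by norm_num)).const_mul C

/-- A sequence of functions with geometrically small steps, the `n`-th of which is `ε n`-nearly
continuous with `ε n → 0`, converges to a continuous function. -/
theorem NearlyContinuousOn.exists_limit {α : Type*} [TopologicalSpace α] {S : Set α} {K : Set X}
    (hK : IsComplete K) {C : ℝ} {ε : ℕ → ℝ} (hε : Filter.Tendsto ε Filter.atTop (𝓝 0))
    {H : ℕ → α → X} (hH : ∀ n, NearlyContinuousOn (ε n) (H n) S) (hHK : ∀ n, MapsTo (H n) S K)
    (hC : ∀ p ∈ S, ∀ n, dist (H n p) (H (n + 1) p) ≤ C / 2 / 2 ^ n) :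
    ∃ L : α → X, ContinuousOn L S ∧
      ∀ p ∈ S, Filter.Tendsto (fun n => H n p) Filter.atTop (𝓝 (L p)) := by
  have h : ∀ p, ∃ l, p ∈ S → Filter.Tendsto (fun n => H n p) Filter.atTop (𝓝 l) := fun p => by
    by_cases hp : p ∈ S
    · obtain ⟨l, -, hl⟩ := cauchySeq_tendsto_of_isComplete hK (fun n => hHK n hp)
        (cauchySeq_of_le_geometric_two (hC p hp))
      exact ⟨l, fun _ => hl⟩
    · exact ⟨H 0 p, fun h => absurd h hp⟩
  choose L hL using h
  refine ⟨L, fun p hp => Metric.tendsto_nhds.2 fun e he => ?_, hL⟩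
  have hdist : ∀ q ∈ S, ∀ n, dist (H n q) (L q) ≤ C / 2 ^ n := fun q hq n =>
    dist_le_of_le_geometric_two_of_tendsto (hC q hq) (hL q hq) n
  have hlim : Filter.Tendsto (fun n : ℕ => C / 2 ^ n + C / 2 ^ n + ε n) Filter.atTop (𝓝 0) := by
    simpa using ((tendsto_div_two_pow_zero C).add (tendsto_div_two_pow_zero C)).add hε
  obtain ⟨n, hn⟩ := (hlim.eventually (gt_mem_nhds he)).exists
  filter_upwards [hH n p hp, self_mem_nhdsWithin] with q hq hqS
  have h1 := hdist q hqS n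
  have h2 := hdist p hp n
  rw [dist_comm] at h1
  have h3 := dist_triangle4 (L q) (H n q) (H n p) (L p)
  linarith

/-- A map of the unit square into the ball of radius `s / 2` that is nearly continuous, and
continuous on the boundary of the square, can be replaced by a continuous map with the same boundary
values. The required `ε` depends on the ball only. -/
theorem IsLengthMetricSpace.exists_continuousOn (hX : IsLengthMetricSpace X)
    (hstable : ∀ (x : X) (R : ℝ) (hR : 0 < R), StableRelativeCover x (R / 10) hR) {y : X} {s : ℝ}
    (hs : 0 < s) (hK : IsCompact (Metric.closedBall y s)) :
    ∃ ε > 0, ∀ H₀ : ℝ × ℝ → X, NearlyContinuousOn ε H₀ unitSquare →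
      ContinuousOn H₀ squareBoundary → MapsTo H₀ unitSquare (Metric.ball y (s / 2)) →
      ∃ L : ℝ × ℝ → X, ContinuousOn L unitSquare ∧ EqOn L H₀ squareBoundary := by
  -- `H n` is refined within `2 * c n`, and these distances add up to `s / 2`
  let c : ℕ → ℝ := fun n => s / 8 / 2 ^ n
  have hcpos : ∀ n, 0 < c n := fun n => by positivity
  choose ρ hρ h using fun n => exists_isApproxHomotopy_of_isCompact hX hstable hK (hcpos n)
  let ε : ℕ → ℝ := fun n => min (ρ n / 4) (c n / 2)
  have hε : ∀ n, 0 < ε n := fun n => lt_min (by linarith [hρ n]) (by linarith [hcpos n])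
  refine ⟨ε 0, hε 0, fun H₀ hH₀ hb hm => ?_⟩
  -- the radii of the successive balls increase from `s / 2` to `s`
  let P : ℕ → (ℝ × ℝ → X) → Prop := fun n H => NearlyContinuousOn (ε n) H unitSquare ∧
    EqOn H H₀ squareBoundary ∧ MapsTo H unitSquare (Metric.closedBall y (s - s / 2 / 2 ^ n))
  have hball : ∀ n, Metric.closedBall y (s - s / 2 / 2 ^ n) ⊆ Metric.closedBall y s := fun n =>
    Metric.closedBall_subset_closedBall (by have : 0 < s / 2 / 2 ^ n := by positivity
                                            linarith)
  have hstep : ∀ n H, ∃ H', P n H → P (n + 1) H' ∧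
      ∀ p ∈ unitSquare, dist (H p) (H' p) ≤ s / 2 / 2 / 2 ^ n := fun n H => by
    by_cases hP : P n H
    swap
    · exact ⟨H, fun h => absurd h hP⟩
    obtain ⟨h1, h2, h3⟩ := hP
    obtain ⟨H', g1, g2, g3⟩ := h1.exists_refinement hX (h n)
      (by linarith [min_le_left (ρ n / 4) (c n / 2)])
      (by linarith [min_le_right (ρ n / 4) (c n / 2)])
      (fun p hp => hball n (h3 hp)) (hb.congr h2) (hε (n + 1))
    have g4 : ∀ p ∈ unitSquare, dist (H p) (H' p) ≤ s / 2 / 2 / 2 ^ n := fun p hp =>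
      (g3 p hp).trans_eq (by simp only [c]; ring)
    refine ⟨H', fun _ => ⟨⟨g1, g2.trans h2, fun p hp => ?_⟩, g4⟩⟩
    have h5 : dist (H p) y ≤ s - s / 2 / 2 ^ n := h3 hp
    have h6 := dist_triangle_left (H' p) y (H p)
    have h7 : s - s / 2 / 2 ^ (n + 1) = s / 2 / 2 / 2 ^ n + (s - s / 2 / 2 ^ n) := by
      rw [pow_succ]; field_simp; ring
    rw [Metric.mem_closedBall, h7]
    linarith [g4 p hp]
  choose next hnext using hstep
  let H : ℕ → ℝ × ℝ → X := fun n => Nat.rec H₀ next n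
  have hP : ∀ n, P n (H n) := fun n => by
    induction n with
    | zero => exact ⟨hH₀, fun _ _ => rfl, fun p hp => by
        have : dist (H₀ p) y < s / 2 := hm hp
        rw [Metric.mem_closedBall, pow_zero]
        exact this.le.trans (by linarith)⟩
    | succ n ih => exact (hnext n (H n) ih).1
  have hεlim : Filter.Tendsto ε Filter.atTop (𝓝 0) := by
    refine squeeze_zero (fun n => (hε n).le) (fun n => min_le_right _ _) ?_
    simpa using (tendsto_div_two_pow_zero (s / 8)).div_const 2
  obtain ⟨L, hL, hLlim⟩ := NearlyContinuousOn.exists_limit hK.isComplete hεlim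
    (fun n => (hP n).1) (fun n p hp => hball n ((hP n).2.2 hp))
    (fun p hp n => (hnext n (H n) (hP n)).2 p hp)
  refine ⟨L, hL, fun p hp => tendsto_nhds_unique (hLlim p hp.1) ?_⟩
  exact tendsto_const_nhds.congr fun n => ((hP n).2.1 hp).symm

theorem IsApproxHomotopy.homotopic_refl {z : X} {γ : Path z z} {ε : ℝ} {H L : ℝ × ℝ → X}
    (hH : IsApproxHomotopy ε γ (Path.refl z) H) (hL : ContinuousOn L unitSquare)
    (h : EqOn L H squareBoundary) : γ.Homotopic (Path.refl z) := by
  refine ⟨{ toFun := fun p => L (p.2, p.1), continuous_toFun := ?_, map_zero_left := ?_,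
            map_one_left := ?_, prop' := ?_ }⟩
  · exact hL.comp_continuous (by fun_prop) fun p => ⟨p.2.2, p.1.2⟩
  · intro t
    have h1 : L (t, 0) = H (t, 0) := h ⟨⟨t.2, by simp⟩, by simp⟩
    simpa [hH.bottom] using h1
  · intro t
    have h1 : L (t, 1) = H (t, 1) := h ⟨⟨t.2, by simp⟩, by simp⟩
    simpa [hH.top] using h1
  · rintro t x (rfl | rfl)
    · have h1 : L (0, t) = H (0, t) := h ⟨⟨by simp, t.2⟩, by simp⟩
      simpa [hH.left] using h1
    · have h1 : L (1, t) = H (1, t) := h ⟨⟨by simp, t.2⟩, by simp⟩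
      simpa [hH.right] using h1

end

end

theorem mainTheorem4 (X : Type*) [MetricSpace X] [LocallyCompactSpace X]
    (hX : IsLengthMetricSpace X)
    (hstable : ∀ (x : X) (R : ℝ) (hR : 0 < R), StableRelativeCover x (R / 10) hR) :
    IsSemilocallySimplyConnected X := by
  intro y
  obtain ⟨s, hs, hK⟩ := Metric.exists_isCompact_closedBall y
  obtain ⟨ε, hε, hL⟩ := hX.exists_continuousOn hstable hs hK
  obtain ⟨ρ, hρ, -, h⟩ := (hstable y (s / 2) (half_pos hs)).exists_isApproxHomotopy hX
  refine ⟨ρ, hρ, fun z γ hγ => ?_⟩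
  have hγ' : ∀ t, γ t ∈ Metric.ball y ρ := fun t => hγ ⟨t, rfl⟩
  obtain ⟨H, hH, hb⟩ := h z z γ (Path.refl z) hγ' (fun _ => by simpa using hγ' 0) ε hε
  obtain ⟨L, hLc, hLb⟩ := hL H
    (hH.nearlyContinuousOn.mono (subset_univ _))
    (hH.continuousOn_squareBoundary) (fun p _ => hb p)
  exact hH.homotopic_refl hLc hLb
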